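/- Let $\lambda$ be a regular infinite cardinal and let $\mathcal C$ be a locally $\lambda$-presentable category. An object $A$ is $\lambda$-presentable if $\mathcal C(A,-)\colon\mathcal C\to\mathbf{Set}$ preserves $\lambda$-filtered colimits, and $\lambda$-generated if $\mathcal C(A,-)$ preserves colimits of $\lambda$-filtered diagrams of monomorphisms. A morphism $f\colon A\to B$ is $\lambda$-presentable if it is a $\lambda$-presentable object of the comma category $(A\downarrow\mathcal C)$. Let $\lambda\text{-Mono}$ be the class of all $\lambda$-presentable monomorphisms of $\mathcal C$, let $\lambda_g\text{-Mono}$ be the class of all monomorphisms of $\mathcal C$ with $\lambda$-generated domain and $\lambda$-presentable codomain, and for a class $\mathcal N$ of morphisms let $\mathrm{Po}(\mathcal N)$ be the class of all pushouts of members of $\mathcal N$ along arbitrary morphisms. An object $K$ is injective with respect to $n\colon A\to B$ if every morphism $A\to K$ factors through $n$; $K$ is $\lambda$-injective (in Fakir's sense) if it is injective with respect to all members of $\lambda_g\text{-Mono}$. Then $$\lambda_g\text{-Mono}\subseteq\lambda\text{-Mono}\subseteq\mathrm{Po}(\lambda_g\text{-Mono}),$$ and an object of $\mathcal C$ is $\lambda$-injective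 if and only if it is injective with respect to all $\lambda$-presentable monomorphisms. Moreover, for every ring $R$ and every right $R$-module $M$, the following are equivalent in the category $\mathbf{Mod}\text{-}R$ of right $R$-modules: (i) $M$ is $\omega$-injective; (ii) $M$ is injective with respect to all $\omega$-presentable (i.e. finitely presentable) monomorphisms; (iii) $M$ is FP-injective, i.e. $\mathrm{Ext}^1_R(F,M)=0$ for every finitely presented right $R$-module $F$. -/

import Mathlib

open CategoryTheory Limits Opposite

universe v u u'

attribute [local instance] Cardinal.fact_isRegular_aleph0

section

variable {C : Type u} [Category.{v} C]

/-- `A` is `κ`-generated if `Hom(A, -)` preserves the colimits of the (small) `κ`-filtered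
diagrams all of whose transition morphisms are monomorphisms. -/
def IsCardinalGenerated (A : C) (κ : Cardinal.{v}) [Fact κ.IsRegular] : Prop :=
  ∀ (J : Type v) [SmallCategory J] [IsCardinalFiltered J κ] (F : J ⥤ C),
    (∀ ⦃i j : J⦄ (a : i ⟶ j), Mono (F.map a)) →
      PreservesColimit F (coyoneda.obj (op A))

/-- A morphism `f : A ⟶ B` is `κ`-presentable if it is a `κ`-presentable object of
the comma category `A ↓ C`. -/
def IsCardinalPresentableHom {A B : C} (f : A ⟶ B) (κ : Cardinal.{v}) [Fact κ.IsRegular] : Prop :=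
  IsCardinalPresentable (Under.mk f) κ

/-- The object `K` is injective with respect to the class of morphisms `N`: every morphism
`A ⟶ K` extends along every `n : A ⟶ B` in `N`. -/
def IsInjectiveWrt (N : MorphismProperty C) (K : C) : Prop :=
  ∀ ⦃A B : C⦄ (n : A ⟶ B), N n → ∀ f : A ⟶ K, ∃ g : B ⟶ K, n ≫ g = f

variable (C)

/-- The class of all `κ`-presentable monomorphisms. -/
def presentableMono (κ : Cardinal.{v}) [Fact κ.IsRegular] : MorphismProperty C :=
  fun _ _ f ↦ Mono f ∧ IsCardinalPresentableHom f κ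

/-- The class of all monomorphisms with `κ`-generated domain and `κ`-presentable codomain. -/
def generatedMono (κ : Cardinal.{v}) [Fact κ.IsRegular] : MorphismProperty C :=
  fun A B f ↦ Mono f ∧ IsCardinalGenerated A κ ∧ IsCardinalPresentable B κ

variable {C}

/-- `K` is `κ`-injective if it is injective with respect to all monomorphisms with
`κ`-generated domain and `κ`-presentable codomain. -/
def IsCardinalInjective (K : C) (κ : Cardinal.{v}) [Fact κ.IsRegular] : Prop :=
  IsInjectiveWrt (generatedMono C κ) K

end

/-- The category `Mod-R` of right `R`-modules, i.e. of modules over the opposite ring. -/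
abbrev RightModuleCat (R : Type u') [Ring R] : Type (u' + 1) :=
  ModuleCat.{u'} Rᵐᵒᵖ

/-- A right `R`-module `M` is FP-injective if `Ext¹(F, M) = 0` for every finitely presented
right `R`-module `F`. -/
def IsFPInjective {R : Type u'} [Ring R] (M : RightModuleCat.{u'} R) : Prop :=
  ∀ F : RightModuleCat.{u'} R, Module.FinitePresentation Rᵐᵒᵖ F →
    Subsingleton (Abelian.Ext.{u'} F M 1)

/-!
Let `κ` be a regular cardinal and `C` a locally `κ`-presentable category.

Since `C` is complete and well-powered, every morphism is a strong epimorphism followed by a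
monomorphism. As the coprojections of a `κ`-filtered colimit of monomorphisms are monomorphisms, a
strong quotient of a `κ`-presentable object is `κ`-generated; conversely a `κ`-generated object `A`
is the `κ`-filtered colimit of the images in `A` of the `κ`-presentable objects mapping to it, hence
equals one of these images. So the `κ`-generated objects are the strong quotients of the
`κ`-presentable ones (`IsCardinalGenerated.exists_strongEpi`, `isCardinalGenerated_of_strongEpi`).

A morphism `A ⟶ B` whose domain is a quotient of a `κ`-presentable object and whose codomain is
`κ`-presentable is `κ`-presentable in `A ↓ C`, because equalities between morphisms out of `A` may
be tested on the presentable object. This gives `generatedMono_le_presentableMono`.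

For the second inclusion, `f : A ⟶ B` is a `κ`-filtered colimit of morphisms `P j ⟶ Q j` between
`κ`-presentable objects (`exists_colimitPresentation_hom`), and so, under `A`, it is the colimit of
the pushouts of these morphisms along `P j ⟶ A`. If `f` is `κ`-presentable, it is a retract of one
of these pushouts (`IsCardinalPresentableHom.exists_retract`). The idempotent is already defined
on `Q j` after pushing out along some `P j ⟶ P k` only, and forcing it to be the identity there, by
a coequalizer of presentable objects, exhibits `f` as a pushout of some `g : P ⟶ Q` with `P` and
`Q` presentable (`IsCardinalPresentableHom.exists_isPushout`). When `f` is a monomorphism, the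
strong epimorphism part of `g` lifts against `f`, so that `f` is also a pushout of the inclusion of
the image of `g` (`presentableMono_le_pushouts`). Injectivity is inherited by pushouts, so the two
injectivity conditions agree.

For modules, `ModuleCat R` is locally `ℵ₀`-presentable because `R` is a presentable strong
generator; presentable modules are finitely presented, and the generated modules are the finite
ones. By the long exact `Ext` sequence of a presentation `0 ⟶ K ⟶ Rⁿ ⟶ F ⟶ 0`, the vanishing
of `Ext¹(F, M)` means that morphisms `K ⟶ M` extend to `Rⁿ`, where `K` is finite. Conversely, the
cokernel of a monomorphism from a finite module to a finitely presented one is finitely presented.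
-/

/-! ### Limits and strong epi-mono factorisations in locally presentable categories -/

section

variable (C : Type u) [Category.{v} C] (κ : Cardinal.{v}) [Fact κ.IsRegular]
  [IsCardinalLocallyPresentable C κ]

include κ

/-- A locally presentable category is complete: it is a reflective subcategory of the category of
presheaves on (a small model of) its presentable objects. -/
theorem hasLimits_of_isCardinalLocallyPresentable : HasLimits C := by
  let P := isCardinalPresentable C κ
  let F : SmallModel.{v} P.FullSubcategory ⥤ C :=
    (equivSmallModel.{v} P.FullSubcategory).inverse ⋙ P.ι
  have : F.IsDense := inferInstance
  let L := uliftYoneda.{v}.leftKanExtension F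
  let adj := Presheaf.uliftYonedaAdjunction.{v} L (uliftYoneda.{v}.leftKanExtensionUnit F)
  let _ : Reflective (Presheaf.restrictedULiftYoneda.{v} F) := ⟨L, adj⟩
  exact ⟨fun J _ => hasLimitsOfShape_of_reflective (Presheaf.restrictedULiftYoneda.{v} F)⟩

/-- A subobject is determined by the morphisms from a small strong generator that factor through
it. -/
theorem wellPowered_of_isCardinalLocallyPresentable : WellPowered.{v} C := by
  have := hasLimits_of_isCardinalLocallyPresentable C κ
  obtain ⟨P, _, hP⟩ := HasCardinalFilteredGenerator.exists_small_generator C κ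
  refine wellPowered_of_isDetecting (𝒢 := P) fun X Y f hf ↦ ?_
  have : Mono f := ⟨fun g h hgh ↦ hP.isStrongGenerator.isSeparating _ _ fun G hG k ↦
    (hf G hG (k ≫ g ≫ f)).unique (by simp) (by simp [hgh])⟩
  exact hP.isStrongGenerator.isIso_of_mono f fun G hG k ↦ (hf G hG k).exists

variable {C}

/-- The image of `f` is the intersection of the subobjects of the codomain through which `f`
factors. -/
theorem exists_strongEpi_mono_factorisation {X Y : C} (f : X ⟶ Y) :
    ∃ (I : C) (e : X ⟶ I) (m : I ⟶ Y), StrongEpi e ∧ Mono m ∧ e ≫ m = f := by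
  have := hasLimits_of_isCardinalLocallyPresentable C κ
  have := wellPowered_of_isCardinalLocallyPresentable C κ
  let J := Shrink.{v} {S : Subobject Y // S.Factors f}
  let S (j : J) : Subobject Y := ((equivShrink _).symm j).1
  have hS (j : J) : (S j).Factors f := ((equivShrink _).symm j).2
  let m := WidePullback.base (fun j ↦ (S j).arrow)
  let e : X ⟶ widePullback Y (fun j ↦ (S j : C)) (fun j ↦ (S j).arrow) :=
    WidePullback.lift f (fun j ↦ (S j).factorThru f (hS j)) (by simp)
  have hm : Mono m := ⟨fun g h hgh ↦ WidePullback.hom_ext _ _ _ (fun j ↦ by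
    rw [← cancel_mono (S j).arrow]; simpa [m] using hgh) hgh⟩
  have hem : e ≫ m = f := WidePullback.lift_base _ _ _ _
  refine ⟨_, e, m, ?_, hm, hem⟩
  rw [← extremalEpi_iff_strongEpi_of_hasPullbacks]
  refine .mk_of_hasEqualizers _ fun Z p i hpi _ ↦ ?_
  have := mono_comp i m
  let T : {S : Subobject Y // S.Factors f} := ⟨Subobject.mk (i ≫ m),
    (Subobject.mk_factors_iff _ _).2 ⟨p, show p ≫ i ≫ m = f by rw [reassoc_of% hpi, hem]⟩⟩
  -- the inclusion of the intersection into the subobject `Z` splits `i`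
  have hT : S (equivShrink _ T) = Subobject.mk (i ≫ m) := by simp [S, T]
  let r := WidePullback.π (fun j ↦ (S j).arrow) (equivShrink _ T) ≫ Subobject.ofLE _ _ hT.le ≫
    (Subobject.underlyingIso (i ≫ m)).hom
  have hr : r ≫ i = 𝟙 _ := by
    rw [← cancel_mono m]
    simp [r, m]
  exact ⟨r, by rw [← cancel_mono i]; simp [hr], hr⟩

end

/-! ### Generated objects are the strong quotients of presentable objects -/

section

variable {C : Type u} [Category.{v} C] (κ : Cardinal.{v}) [Fact κ.IsRegular]
  [IsCardinalLocallyPresentable C κ]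

/-- In a locally `κ`-presentable category, the coprojections of a colimit of a `κ`-filtered diagram
of monomorphisms are monomorphisms, as is tested on `κ`-presentable objects. -/
theorem mono_ι_app_of_isCardinalFiltered {J : Type v} [SmallCategory J] [IsCardinalFiltered J κ]
    {F : J ⥤ C} (hF : ∀ ⦃i j : J⦄ (a : i ⟶ j), Mono (F.map a)) {c : Cocone F} (hc : IsColimit c)
    (j : J) : Mono (c.ι.app j) where
  right_cancellation {Z} g h hgh := by
    obtain ⟨P, _, hP⟩ := HasCardinalFilteredGenerator.exists_small_generator C κ
    refine hP.isStrongGenerator.isSeparating _ _ fun G hG k ↦ ?_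
    have : IsCardinalPresentable G κ := hP.le_isCardinalPresentable _ hG
    obtain ⟨i, a, ha⟩ := IsCardinalPresentable.exists_eq_of_isColimit' κ hc (k ≫ g) (k ≫ h)
      (by simp [hgh])
    have := hF a
    exact (cancel_mono (F.map a)).1 ha

/-- The images of the coprojections of a colimit cocone form a diagram of subobjects with the same
colimit; if that colimit is `κ`-generated, its identity factors through one of these images. -/
theorem IsCardinalGenerated.exists_strongEpi {A : C} (hA : IsCardinalGenerated A κ) :
    ∃ (P : C) (p : P ⟶ A), IsCardinalPresentable P κ ∧ StrongEpi p := by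
  obtain ⟨J, _, _, ⟨p⟩⟩ :=
    (isCardinalFilteredGenerator_isCardinalPresentable C κ).exists_colimitsOfShape A
  choose I e m he hm hem using fun j ↦ exists_strongEpi_mono_factorisation κ (p.ι.app j)
  have hw {i j : J} (a : i ⟶ j) : ∃ f : I i ⟶ I j, f ≫ m j = m i := by
    have sq : CommSq (p.diag.map a ≫ e j) (e i) (m j) (m i) :=
      ⟨by simp [hem]⟩
    exact ⟨sq.lift, sq.fac_right⟩
  choose φ hφ using @hw
  let F : J ⥤ C :=
    { obj := I
      map := φ
      map_id j := by rw [← cancel_mono (m j), hφ, Category.id_comp]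
      map_comp {i j k} a b := by rw [← cancel_mono (m k), Category.assoc, hφ, hφ, hφ] }
  let c : Cocone F := { pt := A, ι := { app := m, naturality i j a := by simp [F, hφ] } }
  have hec (j : J) {Z : C} (s : I j ⟶ Z) (t : A ⟶ Z) (h : p.ι.app j ≫ t = e j ≫ s) :
      m j ≫ t = s := by
    rw [← cancel_epi (e j), reassoc_of% hem, h]
  let d (s : Cocone F) : Cocone p.diag :=
    { pt := s.pt
      ι :=
        { app j := e j ≫ s.ι.app j
          naturality i j a := by
            have : p.diag.map a ≫ e j = e i ≫ φ a := by
              rw [← cancel_mono (m j), Category.assoc, Category.assoc, hφ, hem, hem]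
              simp
            simp [reassoc_of% this, show φ a ≫ s.ι.app j = s.ι.app i from s.w a] } }
  have hc : IsColimit c :=
    { desc s := p.isColimit.desc (d s)
      fac s j := hec j _ _ (p.isColimit.fac (d s) j)
      uniq s t ht := p.isColimit.uniq (d s) t fun j ↦ by
        simpa [d, ← hem] using congr(e j ≫ $(ht j)) }
  have := hA J F fun i j a ↦ mono_of_mono_fac (hφ a)
  obtain ⟨j, i, hi⟩ := exists_hom_of_preservesColimit_coyoneda hc (𝟙 A)
  replace hi : i ≫ m j = 𝟙 A := hi
  have : IsIso (m j) := ⟨i, by rw [← cancel_mono (m j)]; simp [hi], hi⟩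
  exact ⟨_, p.ι.app j, p.prop_diag_obj j, by rw [← hem]; infer_instance⟩

theorem isCardinalGenerated_of_strongEpi {P A : C} [IsCardinalPresentable P κ] (p : P ⟶ A)
    [StrongEpi p] : IsCardinalGenerated A κ := by
  intro J _ _ F hF
  have := isFiltered_of_isCardinalFiltered J κ
  refine ⟨fun {c} hc ↦ ⟨?_⟩⟩
  have hm := mono_ι_app_of_isCardinalFiltered κ hF hc
  refine Types.FilteredColimit.isColimitOf' _ _ (fun (f : A ⟶ c.pt) ↦ ?_) fun j f g hfg ↦ ?_
  · obtain ⟨j, q, hq⟩ := IsCardinalPresentable.exists_hom_of_isColimit κ hc (p ≫ f)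
    have sq : CommSq q p (c.ι.app j) f := ⟨hq⟩
    exact ⟨j, sq.lift, sq.fac_right.symm⟩
  · exact ⟨j, 𝟙 j, congr($((cancel_mono (c.ι.app j)).1 hfg) ≫ F.map (𝟙 j))⟩

end

/-! ### Presentable morphisms; injectivity with respect to pushouts -/

section

variable {C : Type u} [Category.{v} C] (κ : Cardinal.{v}) [Fact κ.IsRegular]

/-- The domain `A` need only be a quotient of a presentable object `P`: two morphisms out of `A`
that agree after composition with a coprojection of a `κ`-filtered colimit agree at a later stage,
as this can be tested on `P`. -/
theorem isCardinalPresentableHom_of_epi {P A B : C} (p : P ⟶ A) [Epi p] (m : A ⟶ B)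
    [IsCardinalPresentable P κ] [IsCardinalPresentable B κ] : IsCardinalPresentableHom m κ := by
  refine ⟨fun J _ _ ↦ ⟨fun {F} ↦ ⟨fun {c} hc ↦ ⟨?_⟩⟩⟩⟩
  have := isFiltered_of_isCardinalFiltered J κ
  have : IsCardinalPresentable (Under.mk m).right κ := ‹IsCardinalPresentable B κ›
  have hc' := isColimitOfPreserves (Under.forget A) hc
  refine Types.FilteredColimit.isColimitOf' _ _ (fun (f : Under.mk m ⟶ c.pt) ↦ ?_)
    fun j (f : Under.mk m ⟶ F.obj j) (g : Under.mk m ⟶ F.obj j) hfg ↦ ?_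
  · obtain ⟨j, (q : B ⟶ (F.obj j).right), (hq : q ≫ (c.ι.app j).right = f.right)⟩ :=
      IsCardinalPresentable.exists_hom_of_isColimit κ hc' f.right
    obtain ⟨k, a, (ha : _ ≫ (F.map a).right = _ ≫ (F.map a).right)⟩ :=
      IsCardinalPresentable.exists_eq_of_isColimit' κ hc' (p ≫ m ≫ q) (p ≫ (F.obj j).hom) (by
        have := Under.w f
        have := Under.w (c.ι.app j)
        dsimp at *
        simp_all)
    refine ⟨k, Under.homMk (q ≫ (F.map a).right) ?_, ?_⟩
    · rw [← cancel_epi p]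
      simpa using ha
    · apply Under.UnderMorphism.ext
      have : (F.map a).right ≫ (c.ι.app k).right = (c.ι.app j).right :=
        congr($(c.w a).right)
      simp [this, hq]
  · obtain ⟨k, a, (ha : _ ≫ (F.map a).right = _ ≫ (F.map a).right)⟩ :=
      IsCardinalPresentable.exists_eq_of_isColimit' κ hc' f.right g.right
        congr(($hfg).right)
    exact ⟨k, a, Under.UnderMorphism.ext ha⟩

variable (C) in
theorem generatedMono_le_presentableMono [IsCardinalLocallyPresentable C κ] :
    generatedMono C κ ≤ presentableMono C κ := by
  rintro A B m ⟨hm, hA, hB⟩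
  obtain ⟨P, p, _, _⟩ := hA.exists_strongEpi
  exact ⟨hm, isCardinalPresentableHom_of_epi κ p m⟩

theorem IsInjectiveWrt.pushouts {N : MorphismProperty C} {K : C} (h : IsInjectiveWrt N K) :
    IsInjectiveWrt N.pushouts K := by
  rintro A B n ⟨X, Y, p, f, g, hp, sq⟩ a
  obtain ⟨b, hb⟩ := h p hp (f ≫ a)
  exact ⟨sq.desc a b hb.symm, by simp⟩

theorem IsInjectiveWrt.of_le {N N' : MorphismProperty C} {K : C} (h : IsInjectiveWrt N' K)
    (hN : N ≤ N') : IsInjectiveWrt N K :=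
  fun _ _ n hn ↦ h n (hN _ hn)

end

/-! ### The arrow category of a locally presentable category -/

section

variable {C : Type u} [Category.{v} C] (κ : Cardinal.{v}) [Fact κ.IsRegular]

/-- The arrow `𝟙 G` corepresents the functor `X ↦ Hom(G, X.left)`. -/
theorem isCardinalPresentable_arrow_id [HasColimits C] (G : C) [IsCardinalPresentable G κ] :
    IsCardinalPresentable (Arrow.mk (𝟙 G)) κ := by
  let e : Arrow.leftFunc ⋙ coyoneda.obj (op G) ≅ coyoneda.obj (op (Arrow.mk (𝟙 G))) :=
    NatIso.ofComponents (fun X ↦ Equiv.toIso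
      { toFun (k : G ⟶ X.left) := (Arrow.homMk k (k ≫ X.hom) (by simp) : Arrow.mk (𝟙 G) ⟶ X)
        invFun (k : Arrow.mk (𝟙 G) ⟶ X) := k.left
        left_inv _ := rfl
        right_inv (k : Arrow.mk (𝟙 G) ⟶ X) := by
          apply Arrow.hom_ext
          · rfl
          · simp }) (fun {X Y} f ↦ by
        ext (k : G ⟶ X.left)
        apply Arrow.hom_ext
        · rfl
        · exact (Category.assoc _ _ _).trans (congr(k ≫ $(Arrow.w f)).trans
            (Category.assoc _ _ _).symm))
  have : (Arrow.leftFunc (C := C)).IsCardinalAccessible κ := ⟨fun _ _ _ ↦ inferInstance⟩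
  exact Functor.isCardinalAccessible_of_natIso e κ

/-- The arrow `⊥_ C ⟶ G` corepresents the functor `X ↦ Hom(G, X.right)`. -/
theorem isCardinalPresentable_arrow_initial [HasColimits C] (G : C) [IsCardinalPresentable G κ] :
    IsCardinalPresentable (Arrow.mk (initial.to G)) κ := by
  let e : Arrow.rightFunc ⋙ coyoneda.obj (op G) ≅ coyoneda.obj (op (Arrow.mk (initial.to G))) :=
    NatIso.ofComponents (fun X ↦ Equiv.toIso
      { toFun (k : G ⟶ X.right) :=
          (Arrow.homMk (initial.to _) k (initial.hom_ext _ _) : Arrow.mk (initial.to G) ⟶ X)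
        invFun (k : Arrow.mk (initial.to G) ⟶ X) := k.right
        left_inv _ := rfl
        right_inv (k : Arrow.mk (initial.to G) ⟶ X) :=
          Arrow.hom_ext _ _ (initial.hom_ext _ _) rfl }) (fun {X Y} f ↦ by
        ext (k : G ⟶ X.right)
        exact Arrow.hom_ext _ _ (initial.hom_ext _ _) rfl)
  have : (Arrow.rightFunc (C := C)).IsCardinalAccessible κ := ⟨fun _ _ _ ↦ inferInstance⟩
  exact Functor.isCardinalAccessible_of_natIso e κ

/-- The arrows `𝟙 G` and `⊥_ C ⟶ G` for the objects `G` satisfying `P`. -/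
noncomputable def arrowGenerator [HasInitial C] (P : ObjectProperty C) : ObjectProperty (Arrow C) :=
  ObjectProperty.ofObj (Sum.elim (fun G : Subtype P ↦ Arrow.mk (𝟙 G.1))
    (fun G : Subtype P ↦ Arrow.mk (initial.to G.1)))

/-- The arrows `⊥_ C ⟶ G` and `𝟙 G`, for `G` in a strong generator of `C`, corepresent evaluation
at the codomain and at the domain, and so form a strong generator of the arrow category. -/
theorem isStrongGenerator_arrow [HasColimits C] {P : ObjectProperty C} (hP : P.IsStrongGenerator) :
    (arrowGenerator P).IsStrongGenerator := by
  rw [ObjectProperty.isStrongGenerator_iff]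
  have hQ₁ (G : C) (hG : P G) :
      arrowGenerator P (Arrow.mk (𝟙 G)) := ObjectProperty.ofObj_apply _
      (Sum.inl ⟨G, hG⟩ : Subtype P ⊕ Subtype P)
  have hQ₂ (G : C) (hG : P G) :
      arrowGenerator P (Arrow.mk (initial.to G)) := ObjectProperty.ofObj_apply _
      (Sum.inr ⟨G, hG⟩ : Subtype P ⊕ Subtype P)
  let l {G : C} {X : Arrow C} (k : G ⟶ X.left) : Arrow.mk (𝟙 G) ⟶ X :=
    Arrow.homMk k (k ≫ X.hom) (by simp)
  let r {G : C} {X : Arrow C} (k : G ⟶ X.right) : Arrow.mk (initial.to G) ⟶ X :=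
    Arrow.homMk (initial.to _) k (by simp)
  have hl {G : C} {X : Arrow C} (u v : Arrow.mk (𝟙 G) ⟶ X) (h : u.left = v.left) : u = v :=
    Arrow.hom_ext _ _ h (by
      simpa [h] using (Arrow.w u).symm.trans (congr($h ≫ X.hom).trans (Arrow.w v)))
  refine ⟨fun X Y f g hfg ↦ ?_, fun X Y i _ hi ↦ ?_⟩
  · ext
    · exact hP.isSeparating _ _ fun G hG k ↦ congr(($(hfg _ (hQ₁ G hG) (l k))).left)
    · exact hP.isSeparating _ _ fun G hG k ↦ congr(($(hfg _ (hQ₂ G hG) (r k))).right)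
  · have : Mono i.left := ⟨fun g h hgh ↦ hP.isSeparating _ _ fun G hG k ↦ by
      have : l (k ≫ g) = l (k ≫ h) := by
        rw [← cancel_mono i]
        exact hl _ _ (by simp [l, hgh])
      exact congr(($this).left)⟩
    have : Mono i.right := ⟨fun g h hgh ↦ hP.isSeparating _ _ fun G hG k ↦ by
      have : r (k ≫ g) = r (k ≫ h) := by
        rw [← cancel_mono i]
        ext <;> simp [r, hgh]
      exact congr(($this).right)⟩
    have : IsIso i.left := hP.isIso_of_mono _ fun G hG k ↦ by
      obtain ⟨j, hj⟩ := hi _ (hQ₁ G hG) (l k)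
      exact ⟨j.left, congr(($hj).left)⟩
    have : IsIso i.right := hP.isIso_of_mono _ fun G hG k ↦ by
      obtain ⟨j, hj⟩ := hi _ (hQ₂ G hG) (r k)
      exact ⟨j.right, congr(($hj).right)⟩
    exact Arrow.isIso_of_isIso_left_of_isIso_right _

/-- Every morphism is a `κ`-filtered colimit, in the arrow category, of morphisms between
`κ`-presentable objects. -/
theorem exists_colimitPresentation_hom [IsCardinalLocallyPresentable C κ] {A B : C} (f : A ⟶ B) :
    ∃ (J : Type v) (_ : SmallCategory J) (_ : IsCardinalFiltered J κ)
      (p : ColimitPresentation J A) (q : ColimitPresentation J B) (γ : p.diag ⟶ q.diag),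
      (∀ j, γ.app j ≫ q.ι.app j = p.ι.app j ≫ f) ∧
        (∀ j, IsCardinalPresentable (p.diag.obj j) κ) ∧
        ∀ j, IsCardinalPresentable (q.diag.obj j) κ := by
  obtain ⟨P, _, hP⟩ := HasCardinalFilteredGenerator.exists_small_generator C κ
  have hQ := isStrongGenerator_arrow hP.isStrongGenerator
  have : ObjectProperty.Small.{v} (arrowGenerator P) :=
    inferInstanceAs (ObjectProperty.Small (ObjectProperty.ofObj _))
  have hQ' : arrowGenerator P ≤ isCardinalPresentable (Arrow C) κ := by
    rintro _ ⟨⟨G, hG⟩ | ⟨G, hG⟩⟩ <;>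
      have : IsCardinalPresentable G κ := hP.le_isCardinalPresentable _ hG
    · exact isCardinalPresentable_arrow_id κ G
    · exact isCardinalPresentable_arrow_initial κ G
  have hArrow : IsCardinalLocallyPresentable (Arrow C) κ :=
    (IsCardinalLocallyPresentable.iff_exists_isStrongGenerator (Arrow C) κ).2
      ⟨_, inferInstance, hQ, hQ'⟩
  -- evaluation at the domain and at the codomain preserves colimits, so it suffices to check the
  -- generating arrows, whose domain and codomain are presentable
  let W : ObjectProperty (Arrow C) := (isCardinalPresentable C κ).inverseImage Arrow.leftFunc ⊓
    (isCardinalPresentable C κ).inverseImage Arrow.rightFunc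
  have hW : isCardinalPresentable (Arrow C) κ ≤ W := by
    rw [IsStrongGenerator.colimitsCardinalClosure_eq_isCardinalPresentable hQ hQ']
    refine ObjectProperty.colimitsCardinalClosure_le _ _ (fun J _ hJ ↦ ⟨?_⟩) ?_
    · rintro X ⟨p⟩
      have := isClosedUnderColimitsOfShape_isCardinalPresentable C (κ := κ) hJ
      exact ⟨ObjectProperty.prop_of_isColimit _ (isColimitOfPreserves Arrow.leftFunc p.isColimit)
          fun j ↦ (p.prop_diag_obj j).1,
        ObjectProperty.prop_of_isColimit _ (isColimitOfPreserves Arrow.rightFunc p.isColimit)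
          fun j ↦ (p.prop_diag_obj j).2⟩
    · rintro _ ⟨⟨G, hG⟩ | ⟨G, hG⟩⟩
      · exact ⟨hP.le_isCardinalPresentable _ hG, hP.le_isCardinalPresentable _ hG⟩
      · have := isClosedUnderColimitsOfShape_isCardinalPresentable C (κ := κ)
          (J := Discrete PEmpty.{1}) (HasCardinalLT.of_le
            ((hasCardinalLT_aleph0_iff _).2 inferInstance) (Cardinal.IsRegular.aleph0_le Fact.out))
        exact ⟨ObjectProperty.prop_of_isColimit _ (colimit.isColimit _) (by simp),
          hP.le_isCardinalPresentable _ hG⟩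
  obtain ⟨J, _, _, ⟨p⟩⟩ :=
    (isCardinalFilteredGenerator_isCardinalPresentable (Arrow C) κ).exists_colimitsOfShape
      (Arrow.mk f)
  refine ⟨J, _, inferInstance, p.map Arrow.leftFunc, p.map Arrow.rightFunc,
    Functor.whiskerLeft p.diag Arrow.leftToRight, fun j ↦ ?_,
    fun j ↦ (hW _ (p.prop_diag_obj j)).1, fun j ↦ (hW _ (p.prop_diag_obj j)).2⟩
  -- the coprojections of `p.map F` are those of `p`, up to composition with an identity
  have h (j : J) : (p.map Arrow.leftFunc).ι.app j = (p.ι.app j).left := Category.comp_id _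
  have h' (j : J) : (p.map Arrow.rightFunc).ι.app j = (p.ι.app j).right := Category.comp_id _
  exact congr((p.diag.obj j).hom ≫ $(h' j)).trans
    ((Arrow.w (p.ι.app j)).symm.trans congr($((h j).symm) ≫ f))

end

/-! ### Presentable morphisms are pushouts of morphisms between presentable objects -/

section

attribute [local simp] pushout.inl_desc pushout.inl_desc_assoc pushout.inr_desc
  pushout.inr_desc_assoc

variable {C : Type u} [Category.{v} C] (κ : Cardinal.{v}) [Fact κ.IsRegular]

/-- If `p` presents `A` as a `κ`-filtered colimit, then `pushout (p.ι.app j) g` is the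
`κ`-filtered colimit of the pushouts of `g` along the transition morphisms out of stage `j`. -/
theorem exists_factorisation_through_pushout [HasPushouts C] {J : Type v} [SmallCategory J]
    [IsCardinalFiltered J κ] {A : C} (p : ColimitPresentation J A) {j : J} {Q : C}
    (g : p.diag.obj j ⟶ Q) {T : C} [IsCardinalPresentable T κ] (t : T ⟶ pushout (p.ι.app j) g) :
    ∃ (k : J) (a : j ⟶ k) (t' : T ⟶ pushout (p.diag.map a) g),
      t' ≫ pushout.desc (p.ι.app k ≫ pushout.inl _ _) (pushout.inr _ _)
        (by simp [pushout.condition]) = t := by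
  have := isFiltered_of_isCardinalFiltered J κ
  have h := isColimitOfPreserves (Under.forget Q) (isColimitOfPreserves (Under.pushout g)
    (p.isColimit.underPost j))
  obtain ⟨k, t', ht'⟩ := IsCardinalPresentable.exists_hom_of_isColimit κ h t
  exact ⟨k.right, k.hom, t', ht'⟩

/-- A presentable morphism is a retract, under its domain, of a pushout of a morphism between
presentable objects. -/
theorem IsCardinalPresentableHom.exists_retract [HasPushouts C] {A B : C} {f : A ⟶ B}
    (hf : IsCardinalPresentableHom f κ) {J : Type v} [SmallCategory J] [IsCardinalFiltered J κ]
    (p : ColimitPresentation J A) (q : ColimitPresentation J B) (γ : p.diag ⟶ q.diag)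
    (hγ : ∀ j, γ.app j ≫ q.ι.app j = p.ι.app j ≫ f) :
    ∃ (j : J) (s : B ⟶ pushout (p.ι.app j) (γ.app j)) (r : pushout (p.ι.app j) (γ.app j) ⟶ B),
      s ≫ r = 𝟙 B ∧ f ≫ s = pushout.inl _ _ ∧ pushout.inl _ _ ≫ r = f := by
  have := isFiltered_of_isCardinalFiltered J κ
  have : Nonempty J := IsFiltered.nonempty
  -- the pushouts of the `γ.app j` along `p.ι.app j` form a diagram under `A` with colimit `f`
  let D : J ⥤ C :=
    { obj j := pushout (p.ι.app j) (γ.app j)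
      map {i j} a := pushout.desc (pushout.inl _ _) (q.diag.map a ≫ pushout.inr _ _)
        (by rw [← γ.naturality_assoc, ← pushout.condition]; simp)
      map_id j := by ext <;> simp
      map_comp a b := by ext <;> simp }
  let σ : (Functor.const J).obj A ⟶ D := { app j := pushout.inl _ _ }
  let c : Cocone D :=
    { pt := B
      ι :=
        { app j := pushout.desc f (q.ι.app j) (hγ j).symm
          naturality i j a := by apply pushout.hom_ext <;> simp [D] } }
  have hσ {X : C} (τ : D ⟶ (Functor.const J).obj X) (i j : J) :
      σ.app i ≫ τ.app i = σ.app j ≫ τ.app j := by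
    have (i j : J) (a : i ⟶ j) : σ.app i ≫ τ.app i = σ.app j ≫ τ.app j := by
      have := τ.naturality a
      simp only [Functor.const_obj_obj, Functor.const_obj_map, Category.comp_id] at this
      rw [← this]
      simp [σ, D]
    rw [this i _ (IsFiltered.leftToMax i j), this j _ (IsFiltered.rightToMax i j)]
  let d (s : Cocone D) : Cocone q.diag :=
    { pt := s.pt
      ι :=
        { app j := pushout.inr _ _ ≫ s.ι.app j
          naturality i j a := by
            simp [← s.w a, D] } }
  have hc : IsColimit c :=
    { desc s := q.isColimit.desc (d s)
      fac s j := by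
        have hd (k : J) : q.ι.app k ≫ q.isColimit.desc (d s) = pushout.inr _ _ ≫ s.ι.app k :=
          q.isColimit.fac (d s) k
        apply pushout.hom_ext
        · refine (pushout.inl_desc_assoc _ _ _ _).trans (p.isColimit.hom_ext fun k ↦ ?_)
          dsimp
          rw [← reassoc_of% (hγ k), hd, ← pushout.condition_assoc]
          exact congr(p.ι.app k ≫ $(hσ s.ι k j))
        · exact (pushout.inr_desc_assoc _ _ _ _).trans (hd j)
      uniq s m hm := q.isColimit.hom_ext fun j ↦ by
        refine .trans ?_ (q.isColimit.fac (d s) j).symm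
        change q.ι.app j ≫ m = pushout.inr _ _ ≫ s.ι.app j
        rw [← hm j, pushout.inr_desc_assoc] }
  have hc' := Under.isColimitLiftCocone D σ c f (by simp [σ, c]) hc
  have : IsCardinalPresentable (Under.mk f) κ := hf
  obtain ⟨j, s, hs⟩ := IsCardinalPresentable.exists_hom_of_isColimit κ hc' (𝟙 (Under.mk f))
  exact ⟨j, s.right, c.ι.app j, congr(($hs).right), Under.w s, by simp [c]⟩

end

section

variable {C : Type u} [Category.{v} C] (κ : Cardinal.{v}) [Fact κ.IsRegular]

theorem isCardinalPresentable_colimit_of_finCategory {K : Type} [SmallCategory K] [FinCategory K]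
    (F : K ⥤ C) [HasColimit F] [∀ k, IsCardinalPresentable (F.obj k) κ] :
    IsCardinalPresentable (colimit F) κ :=
  isCardinalPresentable_of_isColimit _ (colimit.isColimit F) κ
    (HasCardinalLT.of_le ((hasCardinalLT_aleph0_iff _).2 inferInstance)
      (Cardinal.IsRegular.aleph0_le Fact.out))

instance isCardinalPresentable_pushout {X Y Z : C} (f : X ⟶ Y) (g : X ⟶ Z) [HasPushout f g]
    [IsCardinalPresentable X κ] [IsCardinalPresentable Y κ] [IsCardinalPresentable Z κ] :
    IsCardinalPresentable (pushout f g) κ := by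
  have (k : WalkingSpan) : IsCardinalPresentable ((span f g).obj k) κ := by
    rcases k with _ | _ | _ <;> assumption
  exact isCardinalPresentable_colimit_of_finCategory κ (span f g)

instance isCardinalPresentable_coequalizer {X Y : C} (f g : X ⟶ Y) [HasCoequalizer f g]
    [IsCardinalPresentable X κ] [IsCardinalPresentable Y κ] :
    IsCardinalPresentable (coequalizer f g) κ := by
  have (k : WalkingParallelPair) : IsCardinalPresentable ((parallelPair f g).obj k) κ := by
    rcases k with _ | _ <;> assumption
  exact isCardinalPresentable_colimit_of_finCategory κ (parallelPair f g)

theorem IsPushout.of_exists_unique {P Q A B : C} {a : P ⟶ A} {g : P ⟶ Q} {f : A ⟶ B} {b : Q ⟶ B}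
    (w : a ≫ f = g ≫ b) (h : ∀ ⦃Z : C⦄ (x : A ⟶ Z) (y : Q ⟶ Z), a ≫ x = g ≫ y →
      ∃ z : B ⟶ Z, f ≫ z = x ∧ b ≫ z = y)
    (h' : ∀ ⦃Z : C⦄ (z z' : B ⟶ Z), f ≫ z = f ≫ z' → b ≫ z = b ≫ z' → z = z') :
    IsPushout a g f b := by
  choose d hd hd' using h
  exact ⟨⟨w⟩, ⟨PushoutCocone.IsColimit.mk _ (fun s ↦ d s.inl s.inr s.condition)
    (fun s ↦ hd _ _ _) (fun s ↦ hd' _ _ _)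
    (fun s m h₁ h₂ ↦ h' _ _ (by rw [h₁, hd]) (by rw [h₂, hd']))⟩⟩

/-- If `B` is a retract, under `A`, of a pushout `pushout a g`, with idempotent `r ≫ s`, and the
restriction of this idempotent to `Q` lifts along `pushout u g ⟶ pushout a g` to `t`, then `A ⟶ B`
is a pushout of the map from `P'` to the coequalizer of the two maps `Q ⟶ pushout u g`. -/
theorem exists_isPushout_coequalizer_of_retract [HasPushouts C] [HasCoequalizers C]
    {P P' Q A B : C} {u : P ⟶ P'} {a' : P' ⟶ A} {a : P ⟶ A} (hu : u ≫ a' = a) {g : P ⟶ Q}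
    {f : A ⟶ B} {s : B ⟶ pushout a g} {r : pushout a g ⟶ B} (hsr : s ≫ r = 𝟙 B)
    (hfs : f ≫ s = pushout.inl a g) (hr : pushout.inl a g ≫ r = f) {t : Q ⟶ pushout u g}
    (ht : t ≫ pushout.desc (a' ≫ pushout.inl a g) (pushout.inr a g)
      (by rw [← pushout.condition, ← Category.assoc, hu]) = pushout.inr a g ≫ r ≫ s) :
    ∃ b, IsPushout a' (pushout.inl u g ≫ coequalizer.π (pushout.inr u g) t) f b := by
  set π := pushout.desc (a' ≫ pushout.inl a g) (pushout.inr a g)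
    (by rw [← pushout.condition, ← Category.assoc, hu]) with hπ
  have hlπ : pushout.inl u g ≫ π = a' ≫ pushout.inl a g := pushout.inl_desc _ _ _
  have hrπ : pushout.inr u g ≫ π = pushout.inr a g := pushout.inr_desc _ _ _
  let b : coequalizer (pushout.inr u g) t ⟶ B := coequalizer.desc (π ≫ r) (by
    rw [reassoc_of% hrπ, reassoc_of% ht, hsr, Category.comp_id])
  have hb : coequalizer.π (pushout.inr u g) t ≫ b = π ≫ r := coequalizer.π_desc _ _
  refine ⟨b, IsPushout.of_exists_unique ?_ (fun Z x y h ↦ ?_) fun Z z z' h h' ↦ ?_⟩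
  · rw [Category.assoc, hb, reassoc_of% hlπ, hr]
  · have hw : a ≫ x = g ≫ pushout.inr u g ≫ coequalizer.π (pushout.inr u g) t ≫ y := by
      rw [← hu, Category.assoc, h, ← pushout.condition_assoc, Category.assoc]
    let d : pushout a g ⟶ Z := pushout.desc x _ hw
    have hπd : π ≫ d = coequalizer.π (pushout.inr u g) t ≫ y := by
      apply pushout.hom_ext
      · rw [reassoc_of% hlπ, pushout.inl_desc, h, Category.assoc]
      · rw [reassoc_of% hrπ, pushout.inr_desc]
    have hfd : f ≫ s ≫ d = x := by rw [reassoc_of% hfs, pushout.inl_desc]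
    refine ⟨s ≫ d, hfd, ?_⟩
    apply coequalizer.hom_ext
    rw [reassoc_of% hb]
    apply pushout.hom_ext
    · rw [reassoc_of% hlπ, reassoc_of% hr, hfd, h, Category.assoc]
    · rw [reassoc_of% hrπ, ← reassoc_of% ht, hπd, ← coequalizer.condition_assoc]
  · have : r ≫ z = r ≫ z' := by
      apply pushout.hom_ext
      · rw [reassoc_of% hr, reassoc_of% hr, h]
      · rw [← reassoc_of% hrπ, ← reassoc_of% hb, h', reassoc_of% hb, reassoc_of% hrπ]
    rw [← Category.id_comp z, ← hsr, Category.assoc, this, reassoc_of% hsr]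

/-- By `IsCardinalPresentableHom.exists_retract`, the morphism `f` is a retract, under its domain,
of a pushout of some `P ⟶ Q` between presentable objects. As `Q` is presentable, the corresponding
idempotent, restricted to `Q`, is defined at a finite stage, and `f` is obtained by pushing out a
coequalizer formed at that stage. -/
theorem IsCardinalPresentableHom.exists_isPushout [IsCardinalLocallyPresentable C κ] {A B : C}
    {f : A ⟶ B} (hf : IsCardinalPresentableHom f κ) :
    ∃ (P Q : C) (a : P ⟶ A) (g : P ⟶ Q) (b : Q ⟶ B), IsCardinalPresentable P κ ∧
      IsCardinalPresentable Q κ ∧ IsPushout a g f b := by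
  obtain ⟨J, _, _, p, q, γ, hγ, hp, hq⟩ := exists_colimitPresentation_hom κ f
  obtain ⟨j, s, r, hsr, hfs, hr⟩ := hf.exists_retract κ p q γ hγ
  obtain ⟨k, φ, t, ht⟩ := exists_factorisation_through_pushout κ p (γ.app j)
    (pushout.inr _ _ ≫ r ≫ s)
  obtain ⟨b, hb⟩ := exists_isPushout_coequalizer_of_retract (p.w φ) hsr hfs hr ht
  exact ⟨_, _, _, _, _, hp k, inferInstance, hb⟩

/-- A presentable monomorphism is a pushout of some `g : P ⟶ Q` with `P` and `Q` presentable. The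
monomorphism lets the strong epimorphism from `P` to the image of `g` be lifted against it, and `g`
may be replaced by the inclusion of its image. -/
theorem presentableMono_le_pushouts (C : Type u) [Category.{v} C]
    [IsCardinalLocallyPresentable C κ] :
    presentableMono C κ ≤ (generatedMono C κ).pushouts := by
  rintro A B f ⟨_, hf⟩
  obtain ⟨P, Q, a, g, b, hP, hQ, sq⟩ := hf.exists_isPushout κ
  obtain ⟨I, e, m, _, hm, rfl⟩ := exists_strongEpi_mono_factorisation κ g
  have sq' : CommSq a e f (m ≫ b) := ⟨by simp [sq.w]⟩
  refine ⟨I, Q, m, sq'.lift, b, ⟨hm, isCardinalGenerated_of_strongEpi κ e, hQ⟩,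
    IsPushout.of_exists_unique sq'.fac_right (fun Z x y h ↦ ?_)
      fun Z z z' h h' ↦ sq.hom_ext h h'⟩
  have h' : a ≫ x = (e ≫ m) ≫ y := by
    rw [Category.assoc, ← h, sq'.fac_left_assoc]
  exact ⟨sq.desc x y h', sq.inl_desc _ _ _, sq.inr_desc _ _ _⟩

end

theorem isCardinalInjective_iff_isInjectiveWrt_presentableMono {C : Type u} [Category.{v} C]
    (κ : Cardinal.{v}) [Fact κ.IsRegular] [IsCardinalLocallyPresentable C κ] (K : C) :
    IsCardinalInjective K κ ↔ IsInjectiveWrt (presentableMono C κ) K :=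
  ⟨fun h ↦ h.pushouts.of_le (presentableMono_le_pushouts κ C),
    fun h ↦ h.of_le (generatedMono_le_presentableMono C κ)⟩

/-! ### Finiteness conditions in categories of modules -/

namespace ModuleCat

variable (R : Type u') [Ring R]

/-- The module `R` corepresents the forgetful functor, which preserves filtered colimits. -/
instance isCardinalPresentable_of_self :
    IsCardinalPresentable (of R R) Cardinal.aleph0.{u'} := by
  have : PreservesFilteredColimits (coyoneda.obj (op (of R R))) := by
    refine ⟨fun J _ _ ↦ ?_⟩
    refine preservesColimitsOfShape_of_natIso (F := forget (ModuleCat.{u'} R))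
      (NatIso.ofComponents (fun M ↦ Equiv.toIso
        ((LinearMap.ringLmapEquivSelf R ℕ M).symm.toEquiv.trans
          (homEquiv (M := of R R) (N := M)).symm)) ?_)
    intro M N f
    ext x
    apply ModuleCat.hom_ext
    ext
    simp [homEquiv]
  exact isFinitelyPresentable_iff_preservesFilteredColimits.2 this

instance isCardinalPresentable_of_pi (ι : Type) [Finite ι] :
    IsCardinalPresentable (of R (ι → R)) Cardinal.aleph0.{u'} := by
  have : Fintype ι := .ofFinite ι
  have (k : Discrete ι) :
      IsCardinalPresentable ((Discrete.functor fun _ : ι ↦ of R R).obj k) Cardinal.aleph0.{u'} :=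
    isCardinalPresentable_of_self R
  have : IsCardinalPresentable (⨁ fun _ : ι ↦ of R R) Cardinal.aleph0.{u'} :=
    isCardinalPresentable_of_isColimit _ (biproduct.isColimit fun _ : ι ↦ of R R) _
      ((hasCardinalLT_aleph0_iff _).2 inferInstance)
  exact isCardinalPresentable_of_iso (biproductIsoPi (fun _ : ι ↦ of R R)) _

theorem isStrongGenerator_singleton_of_self :
    (ObjectProperty.singleton (of R R)).IsStrongGenerator := by
  have hs : (ObjectProperty.singleton (of R R)).IsSeparating := by
    intro X Y f g h
    ext x
    have := h _ ((ObjectProperty.singleton_iff _ _).2 rfl) (ofHom (LinearMap.toSpanSingleton R X x))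
    simpa using congr($(this).hom 1)
  rw [ObjectProperty.isStrongGenerator_iff]
  refine ⟨hs, fun X Y i _ hi ↦ ?_⟩
  rw [ConcreteCategory.isIso_iff_bijective]
  refine ⟨(mono_iff_injective i).1 inferInstance, fun y ↦ ?_⟩
  obtain ⟨g, hg⟩ := hi _ ((ObjectProperty.singleton_iff _ _).2 rfl)
    (ofHom (LinearMap.toSpanSingleton R Y y))
  exact ⟨g 1, by simpa using congr($(hg).hom 1)⟩

theorem singleton_of_self_le_isCardinalPresentable :
    ObjectProperty.singleton (of R R) ≤
      isCardinalPresentable (ModuleCat.{u'} R) Cardinal.aleph0.{u'} := by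
  rw [ObjectProperty.singleton_le_iff]
  exact isCardinalPresentable_of_self R

instance isCardinalLocallyPresentable :
    IsCardinalLocallyPresentable (ModuleCat.{u'} R) Cardinal.aleph0.{u'} :=
  (IsCardinalLocallyPresentable.iff_exists_isStrongGenerator _ _).2
    ⟨_, inferInstance, isStrongGenerator_singleton_of_self R,
      singleton_of_self_le_isCardinalPresentable R⟩

variable {R}

open scoped Classical in
/-- A finite colimit is the quotient of the finite product of the values of the diagram by the
submodule of relations, to which each arrow contributes a finitely generated submodule. -/
theorem finitePresentation_of_isColimit {J : Type u'} [Category.{u'} J] [Finite J]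
    [Finite (Arrow J)] {F : J ⥤ ModuleCat.{u'} R}
    (hF : ∀ j, Module.FinitePresentation R (F.obj j)) {c : Cocone F} (hc : IsColimit c) :
    Module.FinitePresentation R c.pt := by
  have : Fintype J := .ofFinite J
  let D := ∀ j, F.obj j
  let l : D →ₗ[R] c.pt := LinearMap.lsum R (fun j ↦ F.obj j) ℕ fun j ↦ (c.ι.app j).hom
  let rel (a : Arrow J) : F.obj a.left →ₗ[R] D :=
    LinearMap.single R (fun j ↦ F.obj j) a.left -
      LinearMap.single R (fun j ↦ F.obj j) a.right ∘ₗ (F.map a.hom).hom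
  let N : Submodule R D := ⨆ a, LinearMap.range (rel a)
  have hN : N.FG := Submodule.fg_iSup _ fun a ↦ Submodule.fg_range (rel a)
  have hl (j : J) (x : F.obj j) : l (Pi.single j x) = c.ι.app j x :=
    LinearMap.lsum_piSingle ..
  -- the quotient map of `c.pt` by the range of `l` vanishes on the colimit cocone
  have hsurj : Function.Surjective l := by
    rw [← LinearMap.range_eq_top, ← Submodule.ker_mkQ (LinearMap.range l), LinearMap.ker_eq_top]
    have : ofHom (LinearMap.range l).mkQ = 0 := hc.hom_ext fun j ↦ by
      ext x
      simp only [hom_comp]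
      simpa using ⟨_, hl j x⟩
    exact congr($(this).hom)
  have hker : LinearMap.ker l = N := by
    refine le_antisymm ?_ ?_
    -- the quotient of `D` by the relations is a cocone
    · let s : Cocone F :=
        { pt := of R (D ⧸ N)
          ι :=
            { app j := ofHom (N.mkQ ∘ₗ LinearMap.single R (fun j ↦ F.obj j) j)
              naturality j k a := by
                ext x
                have : rel (Arrow.mk a) x ∈ N :=
                  Submodule.mem_iSup_of_mem (Arrow.mk a) ⟨x, rfl⟩
                have h : rel (Arrow.mk a) x = Pi.single j x - Pi.single k ((F.map a).hom x) := rfl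
                rw [h] at this
                exact ((Submodule.Quotient.eq N).2 this).symm } }
      have h : (hc.desc s).hom ∘ₗ l = N.mkQ := by
        refine LinearMap.pi_ext fun j x ↦ ?_
        rw [LinearMap.comp_apply, hl]
        exact congr($(hc.fac s j).hom x)
      rw [← N.ker_mkQ, ← h]
      exact LinearMap.ker_le_ker_comp _ _
    · refine iSup_le fun a ↦ ?_
      rintro _ ⟨x, rfl⟩
      have := congr($(c.w a.hom).hom x)
      simp [rel, hl]
  exact Module.finitePresentation_of_surjective l hsurj (hker ▸ hN)

/-- The presentable objects are obtained from the generator `R` by iterated finite colimits. -/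
theorem finitePresentation_of_isCardinalPresentable (M : ModuleCat.{u'} R)
    [hM : IsCardinalPresentable M Cardinal.aleph0.{u'}] : Module.FinitePresentation R M := by
  have h : isCardinalPresentable (ModuleCat.{u'} R) Cardinal.aleph0.{u'} ≤
      fun M : ModuleCat.{u'} R ↦ Module.FinitePresentation R M := by
    have : ObjectProperty.IsClosedUnderIsomorphisms
        fun M : ModuleCat.{u'} R ↦ Module.FinitePresentation R M :=
      ⟨fun e _ ↦ .of_equiv e.toLinearEquiv⟩
    rw [IsStrongGenerator.colimitsCardinalClosure_eq_isCardinalPresentable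
      (isStrongGenerator_singleton_of_self R) (singleton_of_self_le_isCardinalPresentable R)]
    refine ObjectProperty.colimitsCardinalClosure_le _ _ (fun J _ hJ ↦ ⟨?_⟩) ?_
    · rintro X ⟨p⟩
      have : Finite (Arrow J) := (hasCardinalLT_aleph0_iff _).1 hJ
      have : Finite J := .of_injective (fun j ↦ Arrow.mk (𝟙 j)) fun i j h ↦ congr($(h).left)
      exact finitePresentation_of_isColimit p.prop_diag_obj p.isColimit
    · rw [ObjectProperty.singleton_le_iff]
      exact inferInstanceAs (Module.FinitePresentation R R)
  exact h _ hM

theorem isCardinalGenerated_of_finite (M : ModuleCat.{u'} R) [Module.Finite R M] :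
    IsCardinalGenerated M Cardinal.aleph0.{u'} := by
  obtain ⟨n, f, hf⟩ := Module.Finite.exists_fin' R M
  have : Epi (ofHom f) := (epi_iff_surjective _).2 hf
  have : StrongEpi (ofHom f) := strongEpi_of_epi _
  exact isCardinalGenerated_of_strongEpi _ (ofHom f)

theorem finite_of_isCardinalGenerated {M : ModuleCat.{u'} R}
    (hM : IsCardinalGenerated M Cardinal.aleph0.{u'}) : Module.Finite R M := by
  obtain ⟨P, p, _, _⟩ := hM.exists_strongEpi
  have := finitePresentation_of_isCardinalPresentable P
  exact .of_surjective p.hom ((epi_iff_surjective p).1 inferInstance)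

end ModuleCat

/-! ### FP-injective modules -/

namespace ModuleCat

variable {R : Type u'} [Ring R]

theorem exists_extension_of_subsingleton_ext {S : ShortComplex (ModuleCat.{u'} R)}
    (hS : S.ShortExact) {M : ModuleCat.{u'} R} [Subsingleton (Abelian.Ext.{u'} S.X₃ M 1)]
    (f : S.X₁ ⟶ M) : ∃ g : S.X₂ ⟶ M, S.f ≫ g = f := by
  obtain ⟨x, hx⟩ := Abelian.Ext.contravariant_sequence_exact₁ hS M (Abelian.Ext.mk₀ f)
    (add_zero 1) (Subsingleton.elim _ _)
  obtain ⟨g, rfl⟩ := (Abelian.Ext.mk₀_bijective _ _).2 x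
  exact ⟨g, (Abelian.Ext.mk₀_bijective _ _).1 (by rwa [Abelian.Ext.mk₀_comp_mk₀] at hx)⟩

theorem subsingleton_ext_of_exists_extension {S : ShortComplex (ModuleCat.{u'} R)}
    (hS : S.ShortExact) [Projective S.X₂] {M : ModuleCat.{u'} R}
    (h : ∀ f : S.X₁ ⟶ M, ∃ g : S.X₂ ⟶ M, S.f ≫ g = f) :
    Subsingleton (Abelian.Ext.{u'} S.X₃ M 1) := by
  refine subsingleton_of_forall_eq 0 fun x ↦ ?_
  obtain ⟨y, rfl⟩ := Abelian.Ext.contravariant_sequence_exact₃ hS M x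
    (Abelian.Ext.eq_zero_of_projective _) (add_zero 1)
  obtain ⟨f, rfl⟩ := (Abelian.Ext.mk₀_bijective _ _).2 y
  obtain ⟨g, rfl⟩ := h f
  rw [← Abelian.Ext.mk₀_comp_mk₀, ← Abelian.Ext.comp_assoc_of_second_deg_zero,
    hS.extClass_comp, Abelian.Ext.zero_comp]

theorem isCardinalInjective_aleph0_iff (M : ModuleCat.{u'} R) :
    IsCardinalInjective M Cardinal.aleph0.{u'} ↔
      ∀ F : ModuleCat.{u'} R, Module.FinitePresentation R F →
        Subsingleton (Abelian.Ext.{u'} F M 1) := by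
  refine ⟨fun h F _ ↦ ?_, fun h A B m ⟨_, hA, hB⟩ f ↦ ?_⟩
  · obtain ⟨n, p, hp⟩ := Module.Finite.exists_fin' R F
    let S := p.shortComplexKer
    have hS : S.ShortExact := p.shortExact_shortComplexKer hp
    have : Module.Finite R S.X₁ := .of_fg (Module.FinitePresentation.fg_ker p hp)
    have : Projective S.X₂ := projective_of_free (Pi.basisFun R (Fin n))
    exact subsingleton_ext_of_exists_extension hS fun f ↦ h S.f
      ⟨hS.mono_f, isCardinalGenerated_of_finite _, isCardinalPresentable_of_pi R (Fin n)⟩ f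
  · have hS : (ShortComplex.mk m (cokernel.π m) (cokernel.condition m)).ShortExact :=
      { exact := ShortComplex.exact_cokernel m }
    have := finite_of_isCardinalGenerated hA
    have := finitePresentation_of_isCardinalPresentable B
    have : Module.FinitePresentation R ↑(cokernel m) :=
      Module.finitePresentation_of_surjective (cokernel.π m).hom
        ((epi_iff_surjective _).1 inferInstance) (by
          rw [← hS.exact.moduleCat_range_eq_ker]
          exact Submodule.fg_range m.hom)
    have := h _ this
    exact exists_extension_of_subsingleton_ext hS f

end ModuleCat

theorem mainTheorem4 :
    (∀ (C : Type u) [Category.{v} C] (κ : Cardinal.{v}) [Fact κ.IsRegular]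
        [IsCardinalLocallyPresentable C κ],
      generatedMono C κ ≤ presentableMono C κ ∧
      presentableMono C κ ≤ (generatedMono C κ).pushouts ∧
      ∀ K : C, IsCardinalInjective K κ ↔ IsInjectiveWrt (presentableMono C κ) K) ∧
    (∀ (R : Type u') [Ring R] (M : RightModuleCat.{u'} R),
      (IsCardinalInjective M Cardinal.aleph0.{u'} ↔ IsFPInjective M) ∧
      (IsInjectiveWrt (presentableMono (RightModuleCat.{u'} R) Cardinal.aleph0.{u'}) M ↔
        IsFPInjective M)) := by
  refine ⟨fun C _ κ _ _ ↦ ⟨generatedMono_le_presentableMono C κ, presentableMono_le_pushouts κ C,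
    isCardinalInjective_iff_isInjectiveWrt_presentableMono κ⟩, fun R _ M ↦ ?_⟩
  have h := ModuleCat.isCardinalInjective_aleph0_iff M
  exact ⟨h, (isCardinalInjective_iff_isInjectiveWrt_presentableMono _ M).symm.trans h⟩
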